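/- Let $n\ge 3$ be an integer, let $\mathbf D=\{z\in\mathbb C : |z|<1\}$, and let $S^1$ be the unit circle with its counterclockwise orientation. Let $(\alpha_i)_{i\in\mathbb Z/n\mathbb Z}$ and $(\omega_i)_{i\in\mathbb Z/n\mathbb Z}$ be two families of points of $S^1$ such that - the $2n$ points $\alpha_i,\omega_i$, $i\in\mathbb Z/n\mathbb Z$, are distinct; - for every $i\in\mathbb Z/n\mathbb Z$, the only one of these points on the open interval of the oriented circle $S^1$ going from $\omega_{i-1}$ to $\omega_i$ is $\alpha_{i+1}$. For every $i\in\mathbb Z/n\mathbb Z$ let $\Gamma_i:\mathbb R\to\mathbf D$ be a continuous, not necessarily injective, map with $\lim_{t\to-\infty}\Gamma_i(t)=\alpha_i$ and $\lim_{t\to+\infty}\Gamma_i(t)=\omega_i$. Suppose that these arcs are in generic position: no $\Gamma_i$ takes the same value at three different parameters; for $i\ne i'$, the set $\Gamma_i(\mathbb R)\cap\Gamma_{i'}(\mathbb R)$ is finite and each of its points is taken by $\Gamma_i$ at exactly one parameter and by $\Gamma_{i'}$ at exactly one parameter; and $\Gamma_i(\mathbb R)\cap\Gamma_{i'}(\mathbb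 R)\cap\Gamma_{i''}(\mathbb R)=\emptyset$ whenever $i,i',i''$ are distinct. Then there is $(t_i)_{i\in\mathbb Z/n\mathbb Z}\in\mathbb R^{\mathbb Z/n\mathbb Z}$ such that - **(A)** the sets $\Gamma_i(]-\infty,t_i[)$, $i\in\mathbb Z/n\mathbb Z$, are pairwise disjoint; - **(B)** for every $i\in\mathbb Z/n\mathbb Z$ there is $i'\notin\{i-1,i\}$ such that $\Gamma_i(]-\infty,t_i])\cap\Gamma_{i'}(]-\infty,t_{i'}])\neq\emptyset$. -/

import Mathlib

open Set Filter Topology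

/-- The open interval of the circle, oriented counterclockwise, that goes from `x` to `y`
(for `x ≠ y`): one reaches `y` from `x` by turning through an angle `t ∈ (0, 2π)`, and the
points of the interval by turning through an angle `s ∈ (0, t)`. -/
def circleIoo (x y : Circle) : Set Circle :=
  {z | ∃ s t : ℝ, 0 < s ∧ s < t ∧ t < 2 * Real.pi ∧
    z = x * Circle.exp s ∧ y = x * Circle.exp t}

/-- The combinatorial hypotheses on the `2 n` endpoints. -/
structure EndpointHypotheses {n : ℕ} (α ω : ZMod n → Circle) : Prop where
  /-- the `2 n` points are distinct -/
  distinct : Function.Injective (Sum.elim α ω)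
  /-- the only one of them on the open interval from `ω (i - 1)` to `ω i` is `α (i + 1)` -/
  linked : ∀ i, (range α ∪ range ω) ∩ circleIoo (ω (i - 1)) (ω i) = {α (i + 1)}

/-- `γ` is a (parametrized, not necessarily simple) arc of the open unit disk that joins the
boundary point `a` to the boundary point `b`. -/
structure JoinsInDisk (γ : ℝ → ℂ) (a b : Circle) : Prop where
  continuous : Continuous γ
  mem_disk : ∀ t, γ t ∈ Metric.ball (0 : ℂ) 1
  tendsto_atBot : Tendsto γ atBot (𝓝 (a : ℂ))
  tendsto_atTop : Tendsto γ atTop (𝓝 (b : ℂ))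

/-- `z` is a double point of the arc `γ`: it is taken at two different parameters. -/
def IsDoublePoint (γ : ℝ → ℂ) (z : ℂ) : Prop :=
  ∃ s t : ℝ, s ≠ t ∧ γ s = z ∧ γ t = z

/-- `z` is a triple point of the arc `γ`: it is taken at three different parameters. -/
def IsTriplePoint (γ : ℝ → ℂ) (z : ℂ) : Prop :=
  ∃ s t u : ℝ, s ≠ t ∧ t ≠ u ∧ s ≠ u ∧ γ s = z ∧ γ t = z ∧ γ u = z

/-- The family of arcs `Γ i` is in generic position. -/
structure GenericArcs {ι : Type*} (Γ : ι → ℝ → ℂ) : Prop where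
  no_triple : ∀ i z, ¬ IsTriplePoint (Γ i) z
  finite_inter : ∀ i j, i ≠ j → (range (Γ i) ∩ range (Γ j)).Finite
  no_double : ∀ i j, i ≠ j → ∀ z ∈ range (Γ i) ∩ range (Γ j),
    ¬ IsDoublePoint (Γ i) z ∧ ¬ IsDoublePoint (Γ j) z
  no_common : ∀ i j k, i ≠ j → j ≠ k → i ≠ k →
    range (Γ i) ∩ range (Γ j) ∩ range (Γ k) = ∅

/-! The theorem is an application of Scarf's lemma to the finite set of crossings, with one linear
order per arc. In the order of `Γ i`, crossings on `Γ i` are sorted by parameter and all others lie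
below them. A crossing is coloured by one of its two arcs, `l`, chosen so that the other is not `l -
1`. Scarf's lemma gives a set `σ` of crossings and a nonempty set `S` of arcs, each the colour of a
member of `σ`, such that every crossing is at least as high as all of `σ` in the order of some arc
of `S`.

If `S` contains every arc, stop `Γ i` at its last point in `σ`. Dominance prevents two arcs from
meeting before their stops, which is (A); the colours give (B).

Otherwise some `i ∉ S` has `i + 1 ∈ S`. Let `y ∈ σ` have colour `i + 1` and second arc `Γ j`. Follow
`Γ (i + 1)` to `y`, then `Γ j` back to `α j`. The endpoints of this path are linked with those of `Γ
i`, so the two meet (`JoinsInDisk.exists_eq_of_linked`), at a crossing strictly before `y` on one of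
its two arcs. This contradicts dominance, since `i ∉ S`. -/

namespace Scarf

/-! ### Dominant sets and a counting lemma -/

section

variable {V I K : Type*} [LinearOrder K]

/-- A set `W` of vectors `Sum.inl x` and slack vectors `Sum.inr i` is dominant if no vector lies
strictly below the maximum of `W` in each of the orders whose slack vector is not in `W`. -/
def Dominant (h : I → V → K) (W : Finset (V ⊕ I)) : Prop :=
  ∀ y : V, ∃ i, Sum.inr i ∉ W ∧ ∀ x, Sum.inl x ∈ W → h i x ≤ h i y

theorem Dominant.mono {h : I → V → K} {W W' : Finset (V ⊕ I)} (hW : Dominant h W')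
    (hsub : W ⊆ W') : Dominant h W := fun y => by
  obtain ⟨i, hi, hx⟩ := hW y
  exact ⟨i, fun hc => hi (hsub hc), fun x hxW => hx x (hsub hxW)⟩

/-- A surjection from a finite set onto a set with one element less identifies exactly two
elements; these are the elements that may be removed. -/
theorem card_removable_eq_two {A B : Type*} [DecidableEq A] [DecidableEq B] (D : Finset A)
    (τ : Finset B) (f : A → B) (hf : ∀ i ∈ D, f i ∈ τ) (hsurj : ∀ x ∈ τ, ∃ i ∈ D, f i = x)
    (hcard : D.card = τ.card + 1) :
    (D.filter fun e => ∀ x ∈ τ, ∃ i ∈ D, i ≠ e ∧ f i = x).card = 2 := by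
  obtain ⟨a, ha, b, hb, hab, hfab⟩ :=
    Finset.exists_ne_map_eq_of_card_lt_of_maps_to (by omega : τ.card < D.card) hf
  rw [Finset.card_eq_two]
  refine ⟨a, b, hab, ?_⟩
  ext e
  simp only [Finset.mem_filter, Finset.mem_insert, Finset.mem_singleton]
  constructor
  · rintro ⟨heD, he⟩
    by_contra! hne
    have hcov : τ ⊆ ((D.erase e).erase a).image f := by
      intro x hx
      obtain ⟨i, hi, hie, rfl⟩ := he x hx
      by_cases hia : i = a
      · exact Finset.mem_image.2 ⟨b, by simp [hb, hab.symm, hne.2.symm], by rw [hia, hfab]⟩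
      · exact Finset.mem_image.2 ⟨i, by simp [hi, hie, hia], rfl⟩
    have h1 := (Finset.card_le_card hcov).trans Finset.card_image_le
    rw [Finset.card_erase_of_mem (by simp [ha, hne.1.symm]), Finset.card_erase_of_mem heD] at h1
    have : 0 < τ.card := Finset.card_pos.2 ⟨_, hf a ha⟩
    omega
  · rintro (rfl | rfl)
    · refine ⟨ha, fun x hx => ?_⟩
      obtain ⟨i, hi, rfl⟩ := hsurj x hx
      by_cases hia : i = e
      · exact ⟨b, hb, hab.symm, by rw [hia, hfab]⟩
      · exact ⟨i, hi, hia, rfl⟩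
    · refine ⟨hb, fun x hx => ?_⟩
      obtain ⟨i, hi, rfl⟩ := hsurj x hx
      by_cases hia : i = e
      · exact ⟨a, ha, hab, by rw [hia, hfab]⟩
      · exact ⟨i, hi, hia, rfl⟩

/-- After `e` is removed, domain and target have equal size, so covering forces injectivity. -/
theorem injOn_erase_of_covers {A B : Type*} [DecidableEq A] [DecidableEq B] {D : Finset A}
    {τ : Finset B} {f : A → B} (hcard : D.card = τ.card + 1) {e : A} (heD : e ∈ D)
    (he : ∀ x ∈ τ, ∃ i ∈ D, i ≠ e ∧ f i = x) :
    Set.InjOn f (D.erase e : Finset A) := by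
  have hcov : τ ⊆ (D.erase e).image f := by
    intro x hx
    obtain ⟨i, hi, hie, rfl⟩ := he x hx
    exact Finset.mem_image_of_mem _ (by simp [hi, hie])
  apply Finset.injOn_of_card_image_eq
  refine le_antisymm Finset.card_image_le ?_
  rw [Finset.card_erase_of_mem heD]
  have := Finset.card_le_card hcov
  omega

end

/-! ### Scarf's lemma by parity -/

section

variable {V I K : Type*} [Fintype V] [DecidableEq V] [Fintype I] [DecidableEq I] [LinearOrder K]

open Classical in
/-- The vectors whose addition to `W` leaves it dominant. -/
noncomputable def extensions (h : I → V → K) (W : Finset (V ⊕ I)) : Finset (V ⊕ I) :=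
  Finset.univ.filter fun v => v ∉ W ∧ Dominant h (insert v W)

theorem mem_extensions {h : I → V → K} {W : Finset (V ⊕ I)} {v : V ⊕ I} :
    v ∈ extensions h W ↔ v ∉ W ∧ Dominant h (insert v W) := by
  simp [extensions]

/-- Sending each order without slack in `W` to its maximal vector of `W` is a surjection from a set
with one element more, so exactly two orders `e` are redundant. Each yields one extension: the `h
e`-least vector lying below the maxima of all the other orders, or the slack of `e` if there is
none. -/
theorem card_extensions_eq_two {h : I → V → K} (hinj : ∀ i, Function.Injective (h i))
    {W : Finset (V ⊕ I)} (hW : Dominant h W) (hcard : W.card + 1 = Fintype.card I)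
    (hne : ∃ x, Sum.inl x ∈ W) : (extensions h W).card = 2 := by
  classical
  set τ : Finset V := Finset.univ.filter fun x => Sum.inl x ∈ W with hτ
  set D : Finset I := Finset.univ.filter fun i => Sum.inr i ∉ W with hD
  have memτ : ∀ x, x ∈ τ ↔ Sum.inl x ∈ W := fun x => by simp [hτ]
  have memD : ∀ i, i ∈ D ↔ Sum.inr i ∉ W := fun i => by simp [hD]
  have hτne : τ.Nonempty := by
    obtain ⟨x, hx⟩ := hne
    exact ⟨x, (memτ x).2 hx⟩
  have hDcard : D.card = τ.card + 1 := by
    have h1 : W = τ.disjSum Dᶜ := by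
      ext (x | i)
      · simp [memτ]
      · simp [memD]
    have h2 := congrArg Finset.card h1
    rw [Finset.card_disjSum, Finset.card_compl] at h2
    have := Finset.card_le_univ D
    omega
  have hm : ∀ i, ∃ x ∈ τ, ∀ x' ∈ τ, h i x' ≤ h i x := fun i =>
    Finset.exists_max_image τ (h i) hτne
  choose m hmτ hmax using hm
  have hmeq : ∀ i, ∀ x ∈ τ, (∀ x' ∈ τ, h i x' ≤ h i x) → m i = x := fun i x hx hx' =>
    hinj i (le_antisymm (hx' _ (hmτ i)) (hmax i x hx))
  have hdom : ∀ y, ∃ i ∈ D, ∀ x ∈ τ, h i x ≤ h i y := fun y => by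
    obtain ⟨i, hi, hx⟩ := hW y
    exact ⟨i, (memD i).2 hi, fun x hxτ => hx x ((memτ x).1 hxτ)⟩
  -- Dominance at `x` itself makes `x` a maximum of `τ` in some order of `D`.
  have hsurj : ∀ x ∈ τ, ∃ i ∈ D, m i = x := fun x hx => by
    obtain ⟨i, hi, hx'⟩ := hdom x
    exact ⟨i, hi, hmeq i x hx hx'⟩
  set E := D.filter fun e => ∀ x ∈ τ, ∃ i ∈ D, i ≠ e ∧ m i = x with hE
  have hE2 : E.card = 2 := by
    rw [hE]
    convert card_removable_eq_two D τ m (fun i _ => hmτ i) hsurj hDcard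
  let M : I → Finset V := fun e => Finset.univ.filter fun y => ∀ i ∈ D, i ≠ e → h i y < h i (m i)
  have memM : ∀ e y, y ∈ M e ↔ ∀ i ∈ D, i ≠ e → h i y < h i (m i) := fun e y => by simp [M]
  have hv : ∀ e, ∃ v : V ⊕ I, (M e = ∅ ∧ v = Sum.inr e) ∨
      ∃ y ∈ M e, (∀ z ∈ M e, h e y ≤ h e z) ∧ v = Sum.inl y := fun e => by
    rcases (M e).eq_empty_or_nonempty with hM | hM
    · exact ⟨_, Or.inl ⟨hM, rfl⟩⟩
    · obtain ⟨y, hy, hmin⟩ := Finset.exists_min_image (M e) (h e) hM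
      exact ⟨_, Or.inr ⟨y, hy, hmin, rfl⟩⟩
  choose v hv using hv
  have himage : extensions h W = E.image v := by
    ext w
    rw [mem_extensions, Finset.mem_image]
    constructor
    · rintro ⟨hwW, hw⟩
      rcases w with y₀ | e
      · have hy₀ : y₀ ∉ τ := fun hc => hwW ((memτ _).1 hc)
        have hw' : ∀ y, ∃ i ∈ D, h i y₀ ≤ h i y ∧ ∀ x ∈ τ, h i x ≤ h i y := fun y => by
          obtain ⟨i, hi, hx⟩ := hw y
          exact ⟨i, (memD i).2 fun hc => hi (Finset.mem_insert_of_mem hc),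
            hx _ (Finset.mem_insert_self _ _),
            fun x hxτ => hx x (Finset.mem_insert_of_mem ((memτ x).1 hxτ))⟩
        -- Dominance at the new vector `y₀` finds the order in which it becomes the maximum; this is
        -- the redundant order.
        obtain ⟨e, heD, -, he⟩ := hw' y₀
        have hcov' : ∀ x ∈ τ, ∃ i ∈ D, i ≠ e ∧ m i = x ∧ h i y₀ ≤ h i x := by
          intro x hx
          obtain ⟨i, hi, hi0, hix⟩ := hw' x
          refine ⟨i, hi, ?_, hmeq i x hx hix, hi0⟩
          rintro rfl
          exact hy₀ (hinj i (le_antisymm hi0 (he x hx)) ▸ hx)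
        have hcov : ∀ x ∈ τ, ∃ i ∈ D, i ≠ e ∧ m i = x := fun x hx => by
          obtain ⟨i, hi, hie, hmi, -⟩ := hcov' x hx
          exact ⟨i, hi, hie, hmi⟩
        have hmi := injOn_erase_of_covers hDcard heD hcov
        have hyM : y₀ ∈ M e := (memM _ _).2 fun i hi hie => by
          obtain ⟨k, hk, hke, hmk, hle⟩ := hcov' (m i) (hmτ i)
          have hki : k = i := hmi (by simp [hk, hke]) (by simp [hi, hie]) hmk
          subst hki
          exact lt_of_le_of_ne hle fun heq => hy₀ (hinj k heq ▸ hmτ k)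
        refine ⟨e, Finset.mem_filter.2 ⟨heD, hcov⟩, ?_⟩
        rcases hv e with ⟨hM, -⟩ | ⟨y, hy, hmin, hvy⟩
        · exact absurd hyM (by simp [hM])
        · rw [hvy]
          congr 1
          obtain ⟨i, hi, hi0, hiτ⟩ := hw' y
          have hie : i = e := by
            by_contra hie
            exact absurd ((memM _ _).1 hy i hi hie) (not_lt.2 (hiτ _ (hmτ i)))
          subst hie
          exact hinj i (le_antisymm (hmin _ hyM) hi0)
      · have heD : e ∈ D := (memD e).2 hwW
        have hw' : ∀ y, ∃ i ∈ D, i ≠ e ∧ ∀ x ∈ τ, h i x ≤ h i y := fun y => by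
          obtain ⟨i, hi, hx⟩ := hw y
          refine ⟨i, (memD i).2 fun hc => hi (Finset.mem_insert_of_mem hc), ?_,
            fun x hxτ => hx x (Finset.mem_insert_of_mem ((memτ x).1 hxτ))⟩
          rintro rfl
          exact hi (Finset.mem_insert_self _ _)
        refine ⟨e, Finset.mem_filter.2 ⟨heD, fun x hx => ?_⟩, ?_⟩
        · obtain ⟨i, hi, hie, hx'⟩ := hw' x
          exact ⟨i, hi, hie, hmeq i x hx hx'⟩
        · rcases hv e with ⟨-, hve⟩ | ⟨y, hy, -, -⟩
          · exact hve
          · obtain ⟨i, hi, hie, hx'⟩ := hw' y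
            exact absurd ((memM _ _).1 hy i hi hie) (not_lt.2 (hx' _ (hmτ i)))
    · rintro ⟨e, he, rfl⟩
      obtain ⟨heD, hcov⟩ := Finset.mem_filter.1 he
      rcases hv e with ⟨hM, hve⟩ | ⟨y₀, hy₀, hmin, hve⟩
      · rw [hve]
        refine ⟨(memD e).1 heD, fun y => ?_⟩
        have hyM : y ∉ M e := by simp [hM]
        rw [memM] at hyM
        push Not at hyM
        obtain ⟨i, hi, hie, hle⟩ := hyM
        refine ⟨i, by simpa [hie] using (memD i).1 hi, fun x hx => ?_⟩
        have hxτ : x ∈ τ := (memτ x).2 (by simpa using hx)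
        exact (hmax i x hxτ).trans hle
      · rw [hve]
        refine ⟨fun hc => ?_, fun y => ?_⟩
        · obtain ⟨i, hi, hie, hmi⟩ := hcov y₀ ((memτ _).2 hc)
          exact absurd ((memM _ _).1 hy₀ i hi hie) (by rw [hmi]; exact lt_irrefl _)
        · by_cases hyM : y ∈ M e
          · obtain ⟨i, hi, hx⟩ := hdom y
            have hie : i = e := by
              by_contra hie
              exact absurd ((memM _ _).1 hyM i hi hie) (not_lt.2 (hx _ (hmτ i)))
            subst hie
            refine ⟨i, by simpa using (memD i).1 hi, fun x hxW => ?_⟩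
            rcases Finset.mem_insert.1 hxW with hx0 | hxW
            · rw [Sum.inl.inj hx0]
              exact hmin y hyM
            · exact hx x ((memτ x).2 hxW)
          · rw [memM] at hyM
            push Not at hyM
            obtain ⟨i, hi, hie, hle⟩ := hyM
            refine ⟨i, by simpa using (memD i).1 hi, fun x hxW => ?_⟩
            rcases Finset.mem_insert.1 hxW with hx0 | hxW
            · rw [Sum.inl.inj hx0]
              exact ((memM _ _).1 hy₀ i hi hie).le.trans hle
            · exact (hmax i x ((memτ x).2 hxW)).trans hle
  rw [himage, Finset.card_image_of_injOn, hE2]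
  intro a _ b _ hab
  rcases hv a with ⟨-, hva⟩ | ⟨y, hy, -, hva⟩ <;> rcases hv b with ⟨-, hvb⟩ | ⟨z, hz, -, hvb⟩ <;>
    rw [hva, hvb] at hab
  · exact Sum.inr.inj hab
  · cases hab
  · cases hab
  -- A vector in both `M a` and `M b` with `a ≠ b` would lie below the maximum in every order of
  -- `D`.
  · obtain rfl := Sum.inl.inj hab
    by_contra hne
    obtain ⟨i, hi, hx⟩ := hdom y
    by_cases hia : i = a
    · exact absurd ((memM _ _).1 hz i hi (hia ▸ hne)) (not_lt.2 (hx _ (hmτ i)))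
    · exact absurd ((memM _ _).1 hy i hi hia) (not_lt.2 (hx _ (hmτ i)))

theorem even_card_extensions {h : I → V → K} (hinj : ∀ i, Function.Injective (h i))
    {W : Finset (V ⊕ I)} (hcard : W.card + 1 = Fintype.card I) (hne : ∃ x, Sum.inl x ∈ W) :
    Even (extensions h W).card := by
  by_cases hW : Dominant h W
  · rw [card_extensions_eq_two hinj hW hcard hne]
    exact even_two
  · have : extensions h W = ∅ := by
      ext v
      simp only [mem_extensions, Finset.notMem_empty, iff_false, not_and]
      exact fun _ hv => hW (hv.mono (Finset.subset_insert _ _))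
    simp [this]

/-- Only the order `i₀` can witness dominance, so the added element must be the `h i₀`-least vector.
-/
theorem card_extensions_slack_eq_one [Nonempty V] {h : I → V → K}
    (hinj : ∀ i, Function.Injective (h i)) {W : Finset (V ⊕ I)} (i₀ : I)
    (hl : ∀ x, Sum.inl x ∉ W) (hr : ∀ i, Sum.inr i ∈ W ↔ i ≠ i₀) :
    (extensions h W).card = 1 := by
  obtain ⟨y₀, -, hy₀⟩ := Finset.exists_min_image (Finset.univ : Finset V) (h i₀)
    Finset.univ_nonempty
  rw [Finset.card_eq_one]
  refine ⟨Sum.inl y₀, ?_⟩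
  ext v
  rw [mem_extensions, Finset.mem_singleton]
  constructor
  · rintro ⟨hvW, hv⟩
    obtain ⟨i, hi, hx⟩ := hv y₀
    have hi0 : i = i₀ := by
      by_contra hne
      exact hi (Finset.mem_insert_of_mem ((hr i).2 hne))
    subst hi0
    rcases v with y | j
    · congr 1
      exact hinj i (le_antisymm (hx y (Finset.mem_insert_self _ _)) (hy₀ y (Finset.mem_univ _)))
    · exfalso
      have hj : j = i := by
        by_contra hne
        exact hvW ((hr j).2 hne)
      exact hi (hj ▸ Finset.mem_insert_self _ _)
  · rintro rfl
    refine ⟨hl _, fun y => ⟨i₀, by simp [hr], fun x hx => ?_⟩⟩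
    rcases Finset.mem_insert.1 hx with hx0 | hxW
    · rw [Sum.inl.inj hx0]
      exact hy₀ y (Finset.mem_univ _)
    · exact absurd hxW (hl x)

/-- **Scarf's lemma**: some dominant set with as many elements as there are orders carries all
the colours, where the slack vector of an order has that order as its colour. -/
theorem exists_dominant_image_eq_univ [Nonempty V] [Nonempty I] {h : I → V → K}
    (hinj : ∀ i, Function.Injective (h i)) (c : V → I) :
    ∃ W : Finset (V ⊕ I), Dominant h W ∧ W.card = Fintype.card I ∧
      W.image (Sum.elim c id) = Finset.univ := by
  classical
  by_contra! hno
  obtain ⟨i₀⟩ := ‹Nonempty I›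
  set col : V ⊕ I → I := Sum.elim c id with hcol
  let P : Finset (Finset (V ⊕ I)) := Finset.univ.filter fun D =>
    D.card + 1 = Fintype.card I ∧ D.image col = Finset.univ.erase i₀
  have memP : ∀ D, D ∈ P ↔ D.card + 1 = Fintype.card I ∧ D.image col = Finset.univ.erase i₀ :=
    fun D => by simp [P]
  have hcardI : (Finset.univ.erase i₀).card + 1 = Fintype.card I :=
    Finset.card_erase_add_one (Finset.mem_univ _)
  have injP : ∀ D ∈ P, Set.InjOn col (D : Set (V ⊕ I)) := fun D hD => by
    obtain ⟨h1, h2⟩ := (memP D).1 hD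
    apply Finset.injOn_of_card_image_eq
    rw [h2]
    omega
  let Q : Finset (Σ _ : Finset (V ⊕ I), V ⊕ I) := P.sigma fun D => extensions h D
  have memQ : ∀ p, p ∈ Q ↔ p.1 ∈ P ∧ p.2 ∉ p.1 ∧ Dominant h (insert p.2 p.1) := fun p => by
    simp only [Q, Finset.mem_sigma, mem_extensions]
  -- The all-slack set contributes one pair; any other member of `P` contains a vector and
  -- contributes an even number.
  have hodd : (Q.card : ZMod 2) = 1 := by
    rw [Finset.card_sigma, Nat.cast_sum]
    set W₀ : Finset (V ⊕ I) := (Finset.univ.erase i₀).image Sum.inr with hW₀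
    have hr : ∀ i, Sum.inr i ∈ W₀ ↔ i ≠ i₀ := fun i => by simp [hW₀]
    have hl : ∀ x, Sum.inl x ∉ W₀ := fun x => by simp [hW₀]
    rw [Finset.sum_eq_single W₀]
    · rw [card_extensions_slack_eq_one hinj i₀ hl hr, Nat.cast_one]
    · intro D hD hne
      obtain ⟨h1, h2⟩ := (memP D).1 hD
      rw [ZMod.natCast_eq_zero_iff_even]
      refine even_card_extensions hinj h1 ?_
      by_contra! hx
      apply hne
      ext (x | i)
      · simp [hx, hl]
      · rw [hr]
        constructor
        · intro hi
          have := h2 ▸ Finset.mem_image_of_mem col hi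
          simpa [hcol] using this
        · intro hi
          have : i ∈ D.image col := by simp [h2, hi]
          obtain ⟨(x | j), hw, hwi⟩ := Finset.mem_image.1 this
          · exact absurd hw (hx x)
          · have : j = i := hwi
            exact this ▸ hw
    · intro hnot
      refine absurd ((memP _).2 ⟨?_, ?_⟩) hnot
      · rw [hW₀, Finset.card_image_of_injective _ Sum.inr_injective, hcardI]
      · rw [hW₀, Finset.image_image]
        ext i
        simp [hcol]
  have hex : ∀ p ∈ Q, ∃ u ∈ p.1, col u = col p.2 := by
    rintro ⟨D, v⟩ hp
    obtain ⟨hD, hv, hdom⟩ := (memQ _).1 hp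
    obtain ⟨h1, h2⟩ := (memP D).1 hD
    have hne : col v ≠ i₀ := by
      intro hc
      refine hno _ hdom ?_ ?_
      · rw [Finset.card_insert_of_notMem hv, h1]
      · rw [Finset.image_insert, h2, hc, Finset.insert_erase (Finset.mem_univ _)]
    have : col v ∈ D.image col := by simp [h2, hne]
    obtain ⟨u, hu, huv⟩ := Finset.mem_image.1 this
    exact ⟨u, hu, huv⟩
  choose! u hu hcu using hex
  have hins : ∀ p ∈ Q, insert (u p) (insert p.2 (p.1.erase (u p))) = insert p.2 p.1 := by
    intro p hp
    rw [Finset.insert_comm, Finset.insert_erase (hu p hp)]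
  have hswap : ∀ p ∈ Q, (⟨insert p.2 (p.1.erase (u p)), u p⟩ : Σ _ : Finset (V ⊕ I), V ⊕ I) ∈ Q := by
    intro p hp
    obtain ⟨hD, hv, hdom⟩ := (memQ _).1 hp
    obtain ⟨h1, h2⟩ := (memP _).1 hD
    have hup := hu p hp
    have hne : u p ≠ p.2 := fun hc => hv (hc ▸ hup)
    rw [memQ]
    refine ⟨(memP _).2 ⟨?_, ?_⟩, ?_, ?_⟩
    · rw [Finset.card_insert_of_notMem (by simp [hv]), Finset.card_erase_add_one hup, h1]
    · rw [Finset.image_insert, ← hcu p hp, ← Finset.image_insert, Finset.insert_erase hup, h2]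
    · simp [hne]
    · simpa only [hins p hp] using hdom
  -- With no fully coloured dominant set, `v` repeats the colour of a unique `u` in `D`; exchanging
  -- them is a fixed-point-free involution.
  have heven : ∑ _p ∈ Q, (1 : ZMod 2) = 0 := by
    refine Finset.sum_involution (fun p _ => ⟨insert p.2 (p.1.erase (u p)), u p⟩) ?_ ?_ hswap ?_
    · intros
      decide
    · intro p hp _ heq
      have hv := ((memQ _).1 hp).2.1
      have h2 := congrArg Sigma.snd heq
      exact hv (h2 ▸ hu p hp)
    · intro p hp
      have hq := hswap p hp
      set q : Σ _ : Finset (V ⊕ I), V ⊕ I := ⟨insert p.2 (p.1.erase (u p)), u p⟩ with hqdef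
      have huq : u q = p.2 := by
        have h3 : p.2 ∈ q.1 := by simp [hqdef]
        exact injP _ ((memQ _).1 hq).1 (hu q hq) h3 ((hcu q hq).trans (hcu p hp))
      obtain ⟨-, hv, -⟩ := (memQ _).1 hp
      have : (⟨insert q.2 (q.1.erase (u q)), u q⟩ : Σ _ : Finset (V ⊕ I), V ⊕ I) = p := by
        rw [huq]
        have h4 : (insert p.2 (p.1.erase (u p))).erase p.2 = p.1.erase (u p) :=
          Finset.erase_insert (by simp [hv])
        have h5 : insert (u p) ((insert p.2 (p.1.erase (u p))).erase p.2) = p.1 := by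
          rw [h4, Finset.insert_erase (hu p hp)]
        simp only [hqdef, h5]
      exact this
  rw [Finset.sum_const, nsmul_eq_mul, mul_one, hodd] at heven
  exact one_ne_zero heven

/-- Scarf's lemma in terms of a set `σ` of vectors and the set `C` of its colours. -/
theorem exists_dominant_colored [Nonempty V] [Nonempty I] {h : I → V → K}
    (hinj : ∀ i, Function.Injective (h i)) (c : V → I) :
    ∃ (σ : Finset V) (C : Finset I), C.Nonempty ∧ (∀ i ∈ C, ∃ x ∈ σ, c x = i) ∧
      ∀ y, ∃ i ∈ C, ∀ x ∈ σ, h i x ≤ h i y := by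
  classical
  obtain ⟨W, hW, -, himg⟩ := exists_dominant_image_eq_univ hinj c
  refine ⟨Finset.univ.filter fun x => Sum.inl x ∈ W, Finset.univ.filter fun i => Sum.inr i ∉ W,
    ?_, ?_, ?_⟩
  · obtain ⟨y⟩ := ‹Nonempty V›
    obtain ⟨i, hi, -⟩ := hW y
    exact ⟨i, by simpa using hi⟩
  · intro i hi
    have : i ∈ W.image (Sum.elim c id) := by simp [himg]
    obtain ⟨(x | j), hw, hwi⟩ := Finset.mem_image.1 this
    · exact ⟨x, by simpa using hw, hwi⟩
    · have hji : j = i := hwi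
      subst hji
      simp [hw] at hi
  · intro y
    obtain ⟨i, hi, hx⟩ := hW y
    exact ⟨i, by simpa using hi, fun x hxW => hx x (by simpa using hxW)⟩

end

end Scarf

/-! ### Linked arcs in the disk -/

theorem one_sub_mem_slitPlane {z : ℂ} (hz : ‖z‖ ≤ 1) (hne : z ≠ 1) : 1 - z ∈ Complex.slitPlane := by
  left
  have hre : z.re ≤ 1 := (Complex.re_le_norm z).trans hz
  rcases hre.lt_or_eq with h | h
  · simpa using h
  · exfalso
    apply hne
    have h1 : z.re * z.re + z.im * z.im ≤ 1 := by
      rw [← Complex.normSq_apply, Complex.normSq_eq_norm_sq]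
      nlinarith [norm_nonneg z]
    have h2 : z.im = 0 := by
      rw [h] at h1
      nlinarith [mul_self_nonneg z.im]
    exact Complex.ext (by simpa using h) (by simpa using h2)

/-- The two logarithms are conjugate, and the half-angle formulas give the argument `θ / 2 - π / 2`.
-/
theorem log_one_sub_exp_sub_log_one_sub_exp_neg {θ : ℝ} (h0 : 0 < θ) (h1 : θ < 2 * Real.pi) :
    Complex.log (1 - Complex.exp (θ * Complex.I)) - Complex.log (1 - Complex.exp (-(θ * Complex.I)))
      = (θ - Real.pi) * Complex.I := by
  set z : ℂ := 1 - Complex.exp (θ * Complex.I) with hz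
  have hsin : 0 < Real.sin (θ / 2) := Real.sin_pos_of_pos_of_lt_pi (by linarith) (by linarith)
  have hpolar : z = ((2 * Real.sin (θ / 2) : ℝ) : ℂ) *
      (Complex.cos ((θ / 2 - Real.pi / 2 : ℝ) : ℂ) +
        Complex.sin ((θ / 2 - Real.pi / 2 : ℝ) : ℂ) * Complex.I) := by
    have hc : Real.cos θ = 1 - 2 * Real.sin (θ / 2) ^ 2 := by
      have h2 := Real.cos_sq_add_sin_sq (θ / 2)
      have h3 := Real.cos_two_mul (θ / 2)
      rw [show 2 * (θ / 2) = θ by ring] at h3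
      linarith
    have hs : Real.sin θ = 2 * Real.sin (θ / 2) * Real.cos (θ / 2) := by
      rw [← Real.sin_two_mul]
      congr 1
      ring
    rw [hz, Complex.exp_mul_I, ← Complex.ofReal_cos, ← Complex.ofReal_sin, ← Complex.ofReal_cos,
      ← Complex.ofReal_sin, Real.cos_sub_pi_div_two, Real.sin_sub_pi_div_two, hc, hs]
    push_cast
    ring
  have harg : z.arg = θ / 2 - Real.pi / 2 := by
    rw [hpolar]
    exact Complex.arg_mul_cos_add_sin_mul_I (by linarith)
      ⟨by linarith, by linarith [Real.pi_pos]⟩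
  have hconj : 1 - Complex.exp (-(θ * Complex.I)) = (starRingEnd ℂ) z := by
    rw [hz, map_sub, map_one, ← Complex.exp_conj, map_mul, Complex.conj_ofReal, Complex.conj_I,
      mul_neg]
  rw [hconj, Complex.log_conj _ (by rw [harg]; linarith [Real.pi_pos]), Complex.sub_conj,
    Complex.log_im, harg]
  push_cast
  ring

/-- A continuous logarithm of `w * (1 - z t)`, where `z` takes values in the closed disk, varies
as the principal logarithm of `1 - z t`. -/
theorem lift_sub_lift_eq_log_sub_log {k z : ℝ → ℂ} (hk : Continuous k) (hz : Continuous z) {w : ℂ}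
    (hnorm : ∀ t, ‖z t‖ ≤ 1) (hne : ∀ t, z t ≠ 1)
    (hexp : ∀ t, Complex.exp (k t) = w * (1 - z t)) (x y : ℝ) :
    k y - k x = Complex.log (1 - z y) - Complex.log (1 - z x) := by
  have hmem : ∀ t, 1 - z t ∈ Complex.slitPlane := fun t => one_sub_mem_slitPlane (hnorm t) (hne t)
  have hcont : Continuous fun t => k t - Complex.log (1 - z t) :=
    hk.sub ((continuous_const.sub hz).clog hmem)
  have hφ : ∀ t, Complex.exp (k t - Complex.log (1 - z t)) = w := fun t => by
    have h0 := Complex.slitPlane_ne_zero (hmem t)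
    rw [Complex.exp_sub, Complex.exp_log h0, hexp, mul_div_cancel_right₀ _ h0]
  have hconst := Complex.isCoveringMap_exp.eq_of_comp_eq hcont
    (continuous_const (y := k x - Complex.log (1 - z x))) (by
      funext t
      apply Subtype.ext
      simp only [Function.comp_apply, hφ]) x rfl
  have := congrFun hconst y
  linear_combination this

theorem exists_continuous_log {F : ℝ × ℝ → ℂ} (hF : Continuous F) (h0 : ∀ p, F p ≠ 0) :
    ∃ G : ℝ × ℝ → ℂ, Continuous G ∧ ∀ p, Complex.exp (G p) = F p := by
  obtain ⟨G, ⟨-, hG⟩, -⟩ := Complex.isCoveringMapOn_exp.existsUnique_continuousMap_lifts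
    (⟨F, hF⟩ : C(ℝ × ℝ, ℂ)) (a₀ := (0, 0)) (e₀ := Complex.log (F (0, 0)))
    (Complex.exp_log (h0 _)) (fun p => h0 p)
  exact ⟨G, G.continuous, fun p => congrFun hG p⟩

/-- The reparametrization of an arc by a segment, constant outside. -/
theorem JoinsInDisk.exists_extension {γ : ℝ → ℂ} {a b : Circle} (h : JoinsInDisk γ a b) :
    ∃ g : ℝ → ℂ, Continuous g ∧ g (-(Real.pi / 2)) = a ∧ g (Real.pi / 2) = b ∧
      ∀ x, g x = a ∨ g x = b ∨ ∃ t, g x = γ t := by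
  have hlt : -(Real.pi / 2) < Real.pi / 2 := by linarith [Real.pi_pos]
  set g₀ := extendFrom (Ioo (-(Real.pi / 2)) (Real.pi / 2)) (γ ∘ Real.tan) with hg₀
  have hc : ContinuousOn (γ ∘ Real.tan) (Ioo (-(Real.pi / 2)) (Real.pi / 2)) :=
    h.continuous.comp_continuousOn Real.continuousOn_tan_Ioo
  have hl : Tendsto (γ ∘ Real.tan) (𝓝[>] (-(Real.pi / 2))) (𝓝 (a : ℂ)) :=
    h.tendsto_atBot.comp Real.tendsto_tan_neg_pi_div_two
  have hr : Tendsto (γ ∘ Real.tan) (𝓝[<] (Real.pi / 2)) (𝓝 (b : ℂ)) :=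
    h.tendsto_atTop.comp Real.tendsto_tan_pi_div_two
  have hcont : ContinuousOn g₀ (Icc (-(Real.pi / 2)) (Real.pi / 2)) :=
    continuousOn_Icc_extendFrom_Ioo hc hl hr
  have hgl : g₀ (-(Real.pi / 2)) = a := eq_lim_at_left_extendFrom_Ioo hlt hl
  have hgr : g₀ (Real.pi / 2) = b := eq_lim_at_right_extendFrom_Ioo hlt hr
  have hgm : ∀ x ∈ Ioo (-(Real.pi / 2)) (Real.pi / 2), g₀ x = γ (Real.tan x) := fun x hx =>
    extendFrom_eq (subset_closure hx) (hc x hx)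
  refine ⟨IccExtend hlt.le ((Icc (-(Real.pi / 2)) (Real.pi / 2)).domRestrict g₀),
    hcont.domRestrict.Icc_extend', ?_, ?_, fun x => ?_⟩
  · rw [IccExtend_left]
    exact hgl
  · rw [IccExtend_right]
    exact hgr
  · rw [IccExtend_apply]
    set y := max (-(Real.pi / 2)) (min (Real.pi / 2) x) with hy
    have hyl : -(Real.pi / 2) ≤ y := le_max_left _ _
    have hyr : y ≤ Real.pi / 2 := max_le hlt.le (min_le_left _ _)
    change g₀ y = a ∨ g₀ y = b ∨ ∃ t, g₀ y = γ t
    rcases hyl.eq_or_lt with h1 | h1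
    · exact Or.inl (by rw [← h1, hgl])
    · rcases hyr.eq_or_lt with h2 | h2
      · exact Or.inr (Or.inl (by rw [h2, hgr]))
      · exact Or.inr (Or.inr ⟨_, hgm y ⟨h1, h2⟩⟩)

/-- Two arcs of the disk whose endpoints are linked on the circle meet. -/
theorem JoinsInDisk.exists_eq_of_linked {γ δ : ℝ → ℂ} {A B C D : ℝ}
    (hγ : JoinsInDisk γ (Circle.exp A) (Circle.exp B))
    (hδ : JoinsInDisk δ (Circle.exp C) (Circle.exp D))
    (hCB : C < B) (hBD : B < D) (hDA : D < A) (hAC : A < C + 2 * Real.pi) :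
    ∃ s t, γ s = δ t := by
  by_contra! hno
  obtain ⟨g, hg, hgl, hgr, hgm⟩ := hγ.exists_extension
  obtain ⟨k, hk, hkl, hkr, hkm⟩ := hδ.exists_extension
  have hdiv : ∀ X Y : ℝ, (Circle.exp X : ℂ) / (Circle.exp Y : ℂ) =
      Complex.exp (((X - Y : ℝ) : ℂ) * Complex.I) := fun X Y => by
    rw [Circle.coe_exp, Circle.coe_exp, ← Complex.exp_sub]
    congr 1
    push_cast
    ring
  have hpair : ∀ X Y : ℝ, Y < X → X < Y + 2 * Real.pi →
      Complex.log (1 - (Circle.exp X : ℂ) / Circle.exp Y) -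
        Complex.log (1 - (Circle.exp Y : ℂ) / Circle.exp X) = (X - Y - Real.pi) * Complex.I := by
    intro X Y h1 h2
    have h3 := log_one_sub_exp_sub_log_one_sub_exp_neg (θ := X - Y) (by linarith) (by linarith)
    rw [hdiv, hdiv, show ((Y - X : ℝ) : ℂ) * Complex.I = -(((X - Y : ℝ) : ℂ) * Complex.I) by
      push_cast; ring, h3]
    push_cast
    ring
  have hexpne : ∀ X Y : ℝ, Y < X → X < Y + 2 * Real.pi →
      (Circle.exp X : ℂ) ≠ Circle.exp Y := by
    intro X Y h1 h2 h3
    have h6 : Complex.exp (((X - Y : ℝ) : ℂ) * Complex.I) = 1 := by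
      rw [← hdiv, h3, div_self (Circle.coe_ne_zero _)]
    rw [Complex.exp_eq_one_iff] at h6
    obtain ⟨m, hm⟩ := h6
    have h7 : X - Y = m * (2 * Real.pi) := by
      have := congrArg Complex.im hm
      simpa using this
    have hpos : (0 : ℝ) < m := by
      by_contra hc
      nlinarith [Real.pi_pos]
    have hlt : (m : ℝ) < 1 := by
      by_contra hc
      nlinarith [Real.pi_pos]
    have h8 : (0 : ℤ) < m := by exact_mod_cast hpos
    have h9 : m < (1 : ℤ) := by exact_mod_cast hlt
    omega
  have hac := hexpne A C (by linarith) hAC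
  have had := hexpne A D hDA (by linarith)
  have hbc := hexpne B C hCB (by linarith)
  have hdb := hexpne D B hBD (by linarith)
  have hγn : ∀ t, ‖γ t‖ < 1 := fun t => by simpa using hγ.mem_disk t
  have hδn : ∀ t, ‖δ t‖ < 1 := fun t => by simpa using hδ.mem_disk t
  have hgnorm : ∀ x, ‖g x‖ ≤ 1 := fun x => by
    rcases hgm x with h | h | ⟨t, h⟩ <;> rw [h]
    · exact (Circle.norm_coe _).le
    · exact (Circle.norm_coe _).le
    · exact (hγn t).le
  have hknorm : ∀ x, ‖k x‖ ≤ 1 := fun x => by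
    rcases hkm x with h | h | ⟨t, h⟩ <;> rw [h]
    · exact (Circle.norm_coe _).le
    · exact (Circle.norm_coe _).le
    · exact (hδn t).le
  have hint : ∀ (z : ℂ) (u : Circle), ‖z‖ < 1 → z ≠ u := fun z u hz hc => by
    rw [hc, Circle.norm_coe] at hz
    exact lt_irrefl _ hz
  have hgk : ∀ x y, g x ≠ k y := fun x y => by
    rcases hgm x with h | h | ⟨t, h⟩ <;> rcases hkm y with h' | h' | ⟨t', h'⟩ <;> rw [h, h']
    · exact hac
    · exact had
    · exact (hint _ _ (hδn _)).symm
    · exact hbc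
    · exact hdb.symm
    · exact (hint _ _ (hδn _)).symm
    · exact hint _ _ (hγn _)
    · exact hint _ _ (hγn _)
    · exact hno t t'
  -- Disjoint arcs would give a logarithm of `g x - k y` on the whole plane, with zero total
  -- variation around a square. On each side one point is fixed on the circle, so the variation is a
  -- difference of principal logarithms.
  obtain ⟨G, hG, hGexp⟩ := exists_continuous_log (F := fun p => g p.1 - k p.2)
    ((hg.comp continuous_fst).sub (hk.comp continuous_snd)) (fun p => sub_ne_zero.2 (hgk _ _))
  set l := -(Real.pi / 2)
  set r := Real.pi / 2
  have vert : ∀ (x : ℝ) (X : ℝ), g x = Circle.exp X → G (x, r) - G (x, l) =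
      Complex.log (1 - (Circle.exp D : ℂ) / Circle.exp X) -
        Complex.log (1 - (Circle.exp C : ℂ) / Circle.exp X) := by
    intro x X hx
    have h0 : (Circle.exp X : ℂ) ≠ 0 := Circle.coe_ne_zero _
    rw [← hkr, ← hkl]
    refine lift_sub_lift_eq_log_sub_log (k := fun y => G (x, y))
      (z := fun y => k y / Circle.exp X) (w := Circle.exp X)
      (hG.comp (by fun_prop)) (by fun_prop) (fun y => ?_) (fun y => ?_) (fun y => ?_) l r
    · rw [norm_div, Circle.norm_coe, div_one]
      exact hknorm y
    · rw [Ne, div_eq_one_iff_eq h0, ← hx]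
      exact (hgk x y).symm
    · rw [hGexp, mul_sub, mul_div_cancel₀ _ h0, mul_one, hx]
  have horiz : ∀ (y : ℝ) (Y : ℝ), k y = Circle.exp Y → G (r, y) - G (l, y) =
      Complex.log (1 - (Circle.exp B : ℂ) / Circle.exp Y) -
        Complex.log (1 - (Circle.exp A : ℂ) / Circle.exp Y) := by
    intro y Y hy
    have h0 : (Circle.exp Y : ℂ) ≠ 0 := Circle.coe_ne_zero _
    rw [← hgr, ← hgl]
    refine lift_sub_lift_eq_log_sub_log (k := fun x => G (x, y))
      (z := fun x => g x / Circle.exp Y) (w := -Circle.exp Y)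
      (hG.comp (by fun_prop)) (by fun_prop) (fun x => ?_) (fun x => ?_) (fun x => ?_) l r
    · rw [norm_div, Circle.norm_coe, div_one]
      exact hgnorm x
    · rw [Ne, div_eq_one_iff_eq h0, ← hy]
      exact hgk x y
    · rw [hGexp, neg_mul, mul_sub, mul_div_cancel₀ _ h0, mul_one, hy]
      ring
  have e1 := vert l A hgl
  have e2 := vert r B hgr
  have e3 := horiz l C hkl
  have e4 := horiz r D hkr
  have p1 := hpair A D hDA (by linarith)
  have p2 := hpair A C (by linarith) hAC
  have p3 := hpair D B hBD (by linarith)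
  have p4 := hpair B C hCB (by linarith)
  -- In the signed sum of the corner terms the angles cancel and the constants `π` leave one full
  -- turn.
  have hfinal : (2 * Real.pi : ℂ) * Complex.I = 0 := by
    linear_combination p1 - p2 + p3 + p4 - e1 + e2 - e4 + e3
  simp [Real.pi_ne_zero] at hfinal

/-! ### Cyclic order of the endpoints; concatenated arcs -/

theorem Circle.exists_eq_mul_exp (u z : Circle) :
    ∃ t : ℝ, 0 ≤ t ∧ t < 2 * Real.pi ∧ z = u * Circle.exp t := by
  set v : ℝ := Complex.arg ((z / u : Circle) : ℂ) with hv
  have hz : z = u * Circle.exp v := by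
    rw [hv, Circle.exp_arg, mul_div_cancel]
  have h1 : -Real.pi < v := Complex.neg_pi_lt_arg _
  have h2 : v ≤ Real.pi := Complex.arg_le_pi _
  have hpi := Real.pi_pos
  rcases le_or_gt 0 v with h | h
  · exact ⟨v, h, by linarith, hz⟩
  · exact ⟨v + 2 * Real.pi, by linarith, by linarith, by rw [Circle.exp_add_two_pi, ← hz]⟩

theorem ZMod.natCast_ne_zero_of_pos_of_lt {n k : ℕ} (h0 : 0 < k) (h1 : k < n) : (k : ZMod n) ≠ 0 := by
  rw [Ne, ZMod.natCast_eq_zero_iff]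
  exact fun h => absurd (Nat.le_of_dvd h0 h) (by omega)

/-- Every endpoint other than the four that surround the interval from `α i` to `ω i` lies, for
suitable angles, strictly between `ω i` and `α i`. -/
theorem EndpointHypotheses.exists_angles {n : ℕ} (hn : 3 ≤ n) {α ω : ZMod n → Circle}
    (h : EndpointHypotheses α ω) (i : ZMod n) :
    ∃ A B C : ℝ, α i = Circle.exp A ∧ ω i = Circle.exp B ∧ α (i + 1) = Circle.exp C ∧
      C < B ∧ A < C + 2 * Real.pi ∧
      ∀ p ∈ range α ∪ range ω, p ≠ α i → p ≠ α (i + 1) → p ≠ ω i → p ≠ ω (i - 1) →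
        ∃ D, p = Circle.exp D ∧ B < D ∧ D < A := by
  have htwo : (2 : ZMod n) ≠ 0 := by
    exact_mod_cast ZMod.natCast_ne_zero_of_pos_of_lt (n := n) (k := 2) (by omega) (by omega)
  have hωinj : Function.Injective ω := fun a b hab =>
    Sum.inr.inj (h.distinct (a₁ := Sum.inr a) (a₂ := Sum.inr b) hab)
  have hαω : ∀ a b, α a ≠ ω b := fun a b hab =>
    Sum.inl_ne_inr (h.distinct (a₁ := Sum.inl a) (a₂ := Sum.inr b) hab)
  have mem1 : ∀ p ∈ range α ∪ range ω, p ∈ circleIoo (ω (i - 1)) (ω i) → p = α (i + 1) :=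
    fun p hp hp' => by
      have : p ∈ (range α ∪ range ω) ∩ circleIoo (ω (i - 1)) (ω i) := ⟨hp, hp'⟩
      rwa [h.linked] at this
  have mem2 : ∀ p ∈ range α ∪ range ω, p ∈ circleIoo (ω (i - 1 - 1)) (ω (i - 1)) → p = α i :=
    fun p hp hp' => by
      have : p ∈ (range α ∪ range ω) ∩ circleIoo (ω (i - 1 - 1)) (ω (i - 1)) := ⟨hp, hp'⟩
      rwa [h.linked, sub_add_cancel] at this
  have h1 : α (i + 1) ∈ circleIoo (ω (i - 1)) (ω i) := by
    have : α (i + 1) ∈ ({α (i + 1)} : Set Circle) := rfl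
    rw [← h.linked] at this
    exact this.2
  have h2 : α i ∈ circleIoo (ω (i - 1 - 1)) (ω (i - 1)) := by
    have : α i ∈ ({α (i - 1 + 1)} : Set Circle) := by rw [sub_add_cancel]; rfl
    rw [← h.linked] at this
    exact this.2
  obtain ⟨s, t, hs, hst, ht, hαs, hωt⟩ := h1
  obtain ⟨s', t', hs', hst', ht', hαs', hωt'⟩ := h2
  obtain ⟨θ, hθ⟩ : ∃ θ : ℝ, ω (i - 1) = Circle.exp θ := ⟨_, (Circle.exp_arg _).symm⟩
  have hprev : ∀ u : ℝ, ω (i - 1) * Circle.exp u = ω (i - 1 - 1) * Circle.exp (t' + u - 2 * Real.pi) :=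
    fun u => by
      rw [Circle.exp_sub_two_pi, Circle.exp_add, ← mul_assoc, ← hωt']
  -- Otherwise `ω i` would equal `ω (i - 2)`, excluded by `n ≥ 3`, or lie between `ω (i - 2)` and `ω
  -- (i - 1)`, where only `α i` is allowed.
  have hgap : t < 2 * Real.pi - t' := by
    by_contra! hc
    rcases hc.eq_or_lt with heq | hlt
    · have h3 : ω i = ω (i - 1 - 1) := by
        rw [hωt, hprev, show t' + t - 2 * Real.pi = 0 by linarith, Circle.exp_zero, mul_one]
      have h4 := hωinj h3
      apply htwo
      linear_combination h4
    · exact hαω i i (mem2 (ω i) (Or.inr ⟨i, rfl⟩)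
        ⟨t' + t - 2 * Real.pi, t', by linarith, by linarith, ht', by rw [← hprev, hωt], hωt'⟩).symm
  -- Angles are measured from `ω (i - 1)` at `θ`; one turn later, `ω (i - 2)` is at `θ + 2π - t'`
  -- and `α i` is `s'` further.
  refine ⟨θ + (2 * Real.pi + s' - t'), θ + t, θ + s, ?_, ?_, ?_, by linarith, by linarith, ?_⟩
  · rw [Circle.exp_add, ← hθ, hprev, hαs']
    congr 2
    ring
  · rw [Circle.exp_add, ← hθ, hωt]
  · rw [Circle.exp_add, ← hθ, hαs]
  · intro p hp hpα hpα' hpω hpω'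
    obtain ⟨u, hu0, hu1, hpu⟩ := Circle.exists_eq_mul_exp (ω (i - 1)) p
    have hupos : 0 < u := by
      rcases hu0.eq_or_lt with h0 | h0
      · exact absurd (by rw [hpu, ← h0, Circle.exp_zero, mul_one]) hpω'
      · exact h0
    have hut : t < u := by
      by_contra! hc
      rcases hc.eq_or_lt with heq | hlt
      · exact hpω (by rw [hpu, heq, hωt])
      · exact hpα' (mem1 p hp ⟨u, t, hupos, hlt, ht, hpu, hωt⟩)
    have hut' : u ≤ 2 * Real.pi - t' := by
      by_contra! hc
      exact hpα (mem2 p hp ⟨t' + u - 2 * Real.pi, t', by linarith, by linarith, ht',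
        by rw [← hprev, hpu], hωt'⟩)
    exact ⟨θ + u, by rw [Circle.exp_add, ← hθ, hpu], by linarith, by linarith⟩

/-- The arc that follows `γ` up to time `s`, then `δ` backwards from time `t`. -/
noncomputable def joinArcs (γ δ : ℝ → ℂ) (s t : ℝ) (u : ℝ) : ℂ :=
  if u ≤ 0 then γ (s + u) else δ (t - u)

theorem JoinsInDisk.joinArcs {γ δ : ℝ → ℂ} {a b c d : Circle} (hγ : JoinsInDisk γ a b)
    (hδ : JoinsInDisk δ c d) {s t : ℝ} (hst : γ s = δ t) :
    JoinsInDisk (joinArcs γ δ s t) a c where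
  continuous := by
    unfold _root_.joinArcs
    refine Continuous.if_le (hγ.continuous.comp (by fun_prop)) (hδ.continuous.comp (by fun_prop))
      continuous_id continuous_const fun u hu => ?_
    have hu0 : u = 0 := hu
    simp [hu0, hst]
  mem_disk u := by
    unfold _root_.joinArcs
    split_ifs
    · exact hγ.mem_disk _
    · exact hδ.mem_disk _
  tendsto_atBot := by
    refine (hγ.tendsto_atBot.comp (tendsto_atBot_add_const_left _ s tendsto_id)).congr' ?_
    filter_upwards [eventually_le_atBot (0 : ℝ)] with u hu
    simp [_root_.joinArcs, hu]
  tendsto_atTop := by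
    have hlim : Tendsto (fun u : ℝ => t - u) atTop atBot := by
      simpa only [sub_eq_add_neg] using
        tendsto_atBot_add_const_left _ t tendsto_neg_atTop_atBot
    refine (hδ.tendsto_atBot.comp hlim).congr' ?_
    filter_upwards [eventually_gt_atTop (0 : ℝ)] with u hu
    simp [_root_.joinArcs, not_le.2 hu]

/-! ### Crossings and their orders -/

section

variable {ι : Type*}

/-- The points that lie on two of the arcs. -/
def crossings (Γ : ι → ℝ → ℂ) : Set ℂ :=
  {z | ∃ i j, i ≠ j ∧ z ∈ range (Γ i) ∧ z ∈ range (Γ j)}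

theorem GenericArcs.finite_crossings [Finite ι] {Γ : ι → ℝ → ℂ} (hgen : GenericArcs Γ) :
    (crossings Γ).Finite := by
  have : crossings Γ = ⋃ i, ⋃ j, ⋃ _ : i ≠ j, range (Γ i) ∩ range (Γ j) := by
    ext z
    simp only [crossings, mem_ofPred_eq, mem_iUnion, mem_inter_iff, exists_prop]
  rw [this]
  exact finite_iUnion fun i => finite_iUnion fun j => finite_iUnion fun hij =>
    hgen.finite_inter i j hij

theorem GenericArcs.param_unique {Γ : ι → ℝ → ℂ} (hgen : GenericArcs Γ) {z : ℂ}
    (hz : z ∈ crossings Γ) {i : ι} {s t : ℝ} (hs : Γ i s = z) (ht : Γ i t = z) : s = t := by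
  obtain ⟨a, b, hab, ha, hb⟩ := hz
  obtain ⟨j, hij, hj⟩ : ∃ j, i ≠ j ∧ z ∈ range (Γ j) := by
    by_cases hia : i = a
    · exact ⟨b, hia ▸ hab, hb⟩
    · exact ⟨a, hia, ha⟩
  by_contra hne
  exact (hgen.no_double i j hij z ⟨⟨s, hs⟩, hj⟩).1 ⟨s, t, hne, hs, ht⟩

theorem GenericArcs.notMem_range {Γ : ι → ℝ → ℂ} (hgen : GenericArcs Γ) {z : ℂ} {i j k : ι}
    (hij : i ≠ j) (hi : z ∈ range (Γ i)) (hj : z ∈ range (Γ j)) (hki : k ≠ i) (hkj : k ≠ j) :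
    z ∉ range (Γ k) := fun hk => by
  have : z ∈ range (Γ i) ∩ range (Γ j) ∩ range (Γ k) := ⟨⟨hi, hj⟩, hk⟩
  rw [hgen.no_common i j k hij hkj.symm hki.symm] at this
  exact this

open Classical in
/-- The parameter of a crossing on the arc `Γ i`; the crossings that are not on `Γ i` come before
all the parameters, in an arbitrary order. -/
noncomputable def crossingKey (Γ : ι → ℝ → ℂ) (e : crossings Γ → ℝ) (i : ι) (z : crossings Γ) :
    ℝ ⊕ₗ ℝ :=
  if h : (z : ℂ) ∈ range (Γ i) then Sum.inrₗ h.choose else Sum.inlₗ (e z)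

theorem GenericArcs.crossingKey_eq {Γ : ι → ℝ → ℂ} (hgen : GenericArcs Γ) (e : crossings Γ → ℝ)
    {i : ι} {z : crossings Γ} {t : ℝ} (ht : Γ i t = z) :
    crossingKey Γ e i z = Sum.inrₗ t := by
  have h : (z : ℂ) ∈ range (Γ i) := ⟨t, ht⟩
  rw [crossingKey, dif_pos h, hgen.param_unique z.2 h.choose_spec ht]

theorem crossingKey_of_notMem {Γ : ι → ℝ → ℂ} (e : crossings Γ → ℝ)
    {i : ι} {z : crossings Γ} (h : (z : ℂ) ∉ range (Γ i)) :
    crossingKey Γ e i z = Sum.inlₗ (e z) := by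
  rw [crossingKey, dif_neg h]

theorem GenericArcs.crossingKey_injective {Γ : ι → ℝ → ℂ} (hgen : GenericArcs Γ)
    {e : crossings Γ → ℝ} (he : Function.Injective e) (i : ι) :
    Function.Injective (crossingKey Γ e i) := by
  intro z w hzw
  by_cases hz : (z : ℂ) ∈ range (Γ i) <;> by_cases hw : (w : ℂ) ∈ range (Γ i)
  · obtain ⟨s, hs⟩ := hz
    obtain ⟨t, ht⟩ := hw
    rw [hgen.crossingKey_eq e hs, hgen.crossingKey_eq e ht] at hzw
    have hst : s = t := by simpa using hzw
    exact Subtype.ext (by rw [← hs, ← ht, hst])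
  · obtain ⟨s, hs⟩ := hz
    rw [hgen.crossingKey_eq e hs, crossingKey_of_notMem e hw] at hzw
    simp at hzw
  · obtain ⟨t, ht⟩ := hw
    rw [crossingKey_of_notMem e hz, hgen.crossingKey_eq e ht] at hzw
    simp at hzw
  · rw [crossingKey_of_notMem e hz, crossingKey_of_notMem e hw] at hzw
    exact he (by simpa using hzw)

/-- Crossings off `Γ i` are lowest, so anything above a point of `Γ i` is itself on `Γ i`. -/
theorem GenericArcs.le_of_crossingKey_le {Γ : ι → ℝ → ℂ} (hgen : GenericArcs Γ)
    {e : crossings Γ → ℝ} {i : ι} {z w : crossings Γ} {s : ℝ} (hs : Γ i s = z)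
    (h : crossingKey Γ e i z ≤ crossingKey Γ e i w) : ∃ t, s ≤ t ∧ Γ i t = w := by
  rw [hgen.crossingKey_eq e hs] at h
  by_cases hw : (w : ℂ) ∈ range (Γ i)
  · obtain ⟨t, ht⟩ := hw
    rw [hgen.crossingKey_eq e ht] at h
    exact ⟨t, by simpa using h, ht⟩
  · rw [crossingKey_of_notMem e hw] at h
    exact absurd h (by simp)

end

/-! ### The main theorem -/

theorem ZMod.exists_mem_add_one_notMem {n : ℕ} [NeZero n] {S : Set (ZMod n)} (hne : S ≠ univ)
    (hS : S.Nonempty) : ∃ i, i ∉ S ∧ i + 1 ∈ S := by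
  by_contra! hno
  obtain ⟨a, ha⟩ := (ne_univ_iff_exists_notMem S).1 hne
  obtain ⟨b, hb⟩ := hS
  have hall : ∀ k : ℕ, a + k ∉ S := by
    intro k
    induction k with
    | zero => simpa using ha
    | succ k ih =>
      have := hno _ ih
      rwa [add_assoc, ← Nat.cast_succ] at this
  have := hall (b - a).val
  rw [ZMod.natCast_zmod_val, add_sub_cancel] at this
  exact this hb

theorem proposition5p1 (n : ℕ) (hn : 3 ≤ n) (α ω : ZMod n → Circle)
    (hαω : EndpointHypotheses α ω) (Γ : ZMod n → ℝ → ℂ)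
    (hΓ : ∀ i, JoinsInDisk (Γ i) (α i) (ω i)) (hgen : GenericArcs Γ) :
    ∃ T : ZMod n → ℝ,
      (∀ i j, i ≠ j → Disjoint (Γ i '' Iio (T i)) (Γ j '' Iio (T j))) ∧
      (∀ i, ∃ i', i' ∉ ({i - 1, i} : Set (ZMod n)) ∧
        (Γ i '' Iic (T i) ∩ Γ i' '' Iic (T i')).Nonempty) := by
  classical
  have : NeZero n := ⟨by omega⟩
  have hone : (1 : ZMod n) ≠ 0 := by
    exact_mod_cast ZMod.natCast_ne_zero_of_pos_of_lt (n := n) (k := 1) (by omega) (by omega)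
  have htwo : (2 : ZMod n) ≠ 0 := by
    exact_mod_cast ZMod.natCast_ne_zero_of_pos_of_lt (n := n) (k := 2) (by omega) (by omega)
  have hsucc : ∀ i : ZMod n, i ≠ i + 1 := fun i h => hone (by linear_combination -h)
  have hαinj : Function.Injective α := fun a b hab =>
    Sum.inl.inj (hαω.distinct (a₁ := Sum.inl a) (a₂ := Sum.inl b) hab)
  have hωinj : Function.Injective ω := fun a b hab =>
    Sum.inr.inj (hαω.distinct (a₁ := Sum.inr a) (a₂ := Sum.inr b) hab)
  have hne : ∀ a b, α a ≠ ω b := fun a b hab =>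
    Sum.inl_ne_inr (hαω.distinct (a₁ := Sum.inl a) (a₂ := Sum.inr b) hab)
  have hmeet : ∀ (i : ZMod n) (δ : ℝ → ℂ) (p : Circle), p ∈ range α ∪ range ω →
      p ≠ α i → p ≠ α (i + 1) → p ≠ ω i → p ≠ ω (i - 1) → JoinsInDisk δ (α (i + 1)) p →
      ∃ s t, Γ i s = δ t := by
    intro i δ p hp h1 h2 h3 h4 hδ
    obtain ⟨A, B, C, hA, hB, hC, hCB, hAC, hD⟩ := hαω.exists_angles hn i
    obtain ⟨D, hpD, hBD, hDA⟩ := hD p hp h1 h2 h3 h4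
    have hi := hΓ i
    rw [hA, hB] at hi
    rw [hC, hpD] at hδ
    exact hi.exists_eq_of_linked hδ hCB hBD hDA hAC
  have : Finite (crossings Γ) := hgen.finite_crossings
  have : Fintype (crossings Γ) := Fintype.ofFinite _
  have : Nonempty (crossings Γ) := by
    obtain ⟨s, t, hst⟩ := hmeet 0 (Γ (0 + 1)) (ω (0 + 1)) (Or.inr ⟨_, rfl⟩) (hne _ _).symm
      (hne _ _).symm (hωinj.ne (hsucc 0).symm)
      (hωinj.ne fun h => htwo (by linear_combination h)) (hΓ _)
    exact ⟨⟨Γ 0 s, 0, 0 + 1, hsucc 0, ⟨s, rfl⟩, ⟨t, hst.symm⟩⟩⟩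
  have hlabel : ∀ z : crossings Γ, ∃ l l', l' ∉ ({l - 1, l} : Set (ZMod n)) ∧
      (z : ℂ) ∈ range (Γ l) ∧ (z : ℂ) ∈ range (Γ l') := by
    rintro ⟨z, i, j, hij, hi, hj⟩
    -- If `j = i - 1`, exchanging the roles works because `i = j - 1` would force `2 = 0`.
    by_cases hji : j = i - 1
    · refine ⟨j, i, ?_, hj, hi⟩
      simp only [mem_insert_iff, mem_singleton_iff, not_or]
      exact ⟨fun h => htwo (by linear_combination h + hji), hij⟩
    · refine ⟨i, j, ?_, hi, hj⟩
      simp only [mem_insert_iff, mem_singleton_iff, not_or]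
      exact ⟨hji, hij.symm⟩
  choose c c' hcc' hc hc' using hlabel
  obtain ⟨e, he⟩ : ∃ e : crossings Γ → ℝ, Function.Injective e := by
    obtain ⟨m, ⟨f⟩⟩ := Finite.exists_equiv_fin (crossings Γ)
    exact ⟨fun z => ((f z : ℕ) : ℝ), fun z w h => f.injective (Fin.ext (Nat.cast_injective h))⟩
  obtain ⟨σ, S, hS, hcol, hdom⟩ :=
    Scarf.exists_dominant_colored (fun i => hgen.crossingKey_injective he i) c
  by_cases huniv : (S : Set (ZMod n)) = univ
  · have hS' : ∀ i, i ∈ S := fun i => by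
      have : i ∈ (S : Set (ZMod n)) := huniv ▸ mem_univ i
      exact this
    -- The highest element of `σ` in order `i` is above one of colour `i`, hence lies on `Γ i`.
    have hT : ∀ i, ∃ t, (∃ x ∈ σ, Γ i t = (x : ℂ)) ∧
        ∀ x ∈ σ, ∀ s, Γ i s = (x : ℂ) → s ≤ t := by
      intro i
      obtain ⟨y, hy, hyi⟩ := hcol i (hS' i)
      obtain ⟨x, hx, hmax⟩ := Finset.exists_max_image σ (crossingKey Γ e i) ⟨y, hy⟩
      obtain ⟨s, hs⟩ : (y : ℂ) ∈ range (Γ i) := hyi ▸ hc y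
      obtain ⟨t, -, ht⟩ := hgen.le_of_crossingKey_le hs (hmax y hy)
      refine ⟨t, ⟨x, hx, ht⟩, fun x' hx' s' hs' => ?_⟩
      obtain ⟨t', hst', ht'⟩ := hgen.le_of_crossingKey_le hs' (hmax x' hx')
      rwa [hgen.param_unique x.2 ht ht']
    choose T hTσ hTmax using hT
    refine ⟨T, fun i j hij => ?_, fun i => ?_⟩
    · rw [Set.disjoint_left]
      rintro z ⟨s, hs, hsz⟩ ⟨t, ht, htz⟩
      have hz : z ∈ crossings Γ := ⟨i, j, hij, ⟨s, hsz⟩, ⟨t, htz⟩⟩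
      -- The order `k` puts `z` on `Γ k` no earlier than `T k`; with no triple crossings, `k` is `i`
      -- or `j`.
      obtain ⟨k, -, hk⟩ := hdom ⟨z, hz⟩
      obtain ⟨x, hx, hxk⟩ := hTσ k
      obtain ⟨u, hu, huz⟩ := hgen.le_of_crossingKey_le hxk (hk x hx)
      have huz' : Γ k u = z := huz
      by_cases hki : k = i
      · subst hki
        rw [hgen.param_unique hz huz' hsz] at hu
        exact absurd hs (not_lt.2 hu)
      · by_cases hkj : k = j
        · subst hkj
          rw [hgen.param_unique hz huz' htz] at hu
          exact absurd ht (not_lt.2 hu)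
        · exact hgen.notMem_range hij ⟨s, hsz⟩ ⟨t, htz⟩ hki hkj ⟨u, huz'⟩
    · obtain ⟨y, hy, rfl⟩ := hcol i (hS' i)
      obtain ⟨s, hs⟩ := hc y
      obtain ⟨t, ht⟩ := hc' y
      exact ⟨c' y, hcc' y, y, ⟨s, hTmax _ y hy s hs, hs⟩, ⟨t, hTmax _ y hy t ht, ht⟩⟩
  · exfalso
    obtain ⟨i, hi, hi'⟩ := ZMod.exists_mem_add_one_notMem huniv (by simpa using hS)
    obtain ⟨y, hy, hyi⟩ := hcol (i + 1) hi'
    have hj := hcc' y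
    set j := c' y with hjdef
    rw [hyi, add_sub_cancel_right] at hj
    simp only [mem_insert_iff, mem_singleton_iff, not_or] at hj
    obtain ⟨s, hs⟩ : (y : ℂ) ∈ range (Γ (i + 1)) := hyi ▸ hc y
    obtain ⟨t, ht⟩ : (y : ℂ) ∈ range (Γ j) := hc' y
    obtain ⟨r, u, hru⟩ := hmeet i (joinArcs (Γ (i + 1)) (Γ j) s t) (α j) (Or.inl ⟨j, rfl⟩)
      (hαinj.ne hj.1) (hαinj.ne hj.2) (hne _ _) (hne _ _)
      ((hΓ _).joinArcs (hΓ j) (hs.trans ht.symm))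
    have hyΓ : (y : ℂ) ∉ range (Γ i) :=
      hgen.notMem_range (Ne.symm hj.2) ⟨s, hs⟩ ⟨t, ht⟩ (hsucc i) (Ne.symm hj.1)
    -- A crossing of `Γ i` strictly before `y` on an arc through `y` contradicts dominance.
    have key : ∀ k, i ≠ k → ∀ v w : ℝ, Γ k v = y → Γ i r = Γ k w → v ≤ w := by
      intro k hik v w hv hw
      have hz : Γ i r ∈ crossings Γ := ⟨i, k, hik, ⟨r, rfl⟩, ⟨w, hw.symm⟩⟩
      obtain ⟨l, hl, hlx⟩ := hdom ⟨_, hz⟩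
      obtain ⟨x, hx, rfl⟩ := hcol l hl
      obtain ⟨v', hv'⟩ := hc x
      -- The crossing is above a point of colour `l`, so it lies on `Γ l`; since `l ≠ i`, this arc
      -- is `Γ k`.
      obtain ⟨w', -, hw'⟩ := hgen.le_of_crossingKey_le hv' (hlx x hx)
      have hli : c x ≠ i := fun h => hi (h ▸ hl)
      have hlk : c x = k := by
        by_contra hlk
        exact hgen.notMem_range hik ⟨r, rfl⟩ ⟨w, hw.symm⟩ hli hlk ⟨w', hw'⟩
      obtain ⟨w'', hvw, hw''⟩ := hgen.le_of_crossingKey_le (hlk ▸ hv) (hlx y hy)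
      rw [hlk] at hw''
      rwa [hgen.param_unique hz hw'' hw.symm] at hvw
    unfold joinArcs at hru
    split_ifs at hru with hu
    · have hle := key (i + 1) (hsucc i) s (s + u) hs hru
      have hu0 : u = 0 := by linarith
      rw [hu0, add_zero, hs] at hru
      exact hyΓ ⟨r, hru⟩
    · have := key j (Ne.symm hj.1) t (t - u) ht hru
      linarith
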